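/- \textbf{Theorem.} Let a group $G$ act on a ring $A$ by inner automorphisms $g(a)=x(g)\,a\,x(g)^{-1}$, where $x\colon G\to A^\times$ is a group homomorphism. For a ring $R$ with an action of $G$ by ring automorphisms, let $R\rtimes G$ denote the twisted group ring, i.e. the free left $R$-module on the elements of $G$, with multiplication determined by $(r\cdot g)(s\cdot h)=r\,g(s)\cdot gh$. (a) There is a ring isomorphism $A\rtimes G\cong A[G]$ which is the identity on $A$. (b) Let $k$ be a commutative ring (for instance $\mathbb Z$) such that $A$ is a $k$-algebra, and let $C$ be a $k$-algebra on which $G$ acts by $k$-algebra automorphisms. Let $G$ act diagonally on $C\otimes_k A$. Then there is a $k$-algebra isomorphism $(C\otimes_k A)\rtimes G\cong (C\rtimes G)\otimes_k A$ which sends $c\otimes a$ to $c\otimes a$ for all $c\in C$, $a\in A$. (c) Suppose moreover that $G$ is finite and that $A$ is a finite-dimensional Banach $\mathbb R$-algebra with unit. Let $X$ be a topological space on which $G$ acts by homeomorphisms. An $A$-bundle on $X$ is a locally trivial bundle $E\to X$ of left $A$-modules with finitely generated projective fibers (with their canonical topology) such that $A\times E\to E$ is continuous. If $G$ acts on $A$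 by $\mathbb R$-algebra automorphisms, a $G$-$A$ bundle is an $A$-bundle $E$ with a continuous action of $G$ on its total space, $g$ mapping $E_p$ additively to $E_{gp}$ for $p\in X$, such that $g(a\cdot e)=g(a)\cdot g(e)$ for $a\in A$, $e\in E$. Let $K_G^A(X)$ be the Grothendieck group of the additive category of $G$-$A$ bundles on $X$. Then $K_G^A(X)$, formed with the action of $G$ on $A$ through $x$, is isomorphic, naturally in the $G$-space $X$, to the usual equivariant $K$-theory of $A$-bundles, that is, to the group $K_G^A(X)$ formed with the trivial action of $G$ on $A$. In particular, $K_G^A(X)$ is independent of the representation $x$: any two homomorphisms $x,y\colon G\to A^\times$ give groups that are isomorphic naturally in $X$. -/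

import Mathlib

open scoped TensorProduct

universe u v w

namespace EquivariantBundles

section Algebra

/-- The diagonal action `g • (c ⊗ a) = (g • c) ⊗ (g • a)` of `G` on the tensor product of two
`k`-algebras on which `G` acts by `k`-algebra automorphisms. -/
@[reducible]
noncomputable def diagonalAction (k G C A : Type*) [CommRing k] [Group G]
    [Ring C] [Algebra k C] [MulSemiringAction G C] [SMulCommClass G k C]
    [Ring A] [Algebra k A] [MulSemiringAction G A] [SMulCommClass G k A] :
    MulSemiringAction G (C ⊗[k] A) :=
  MulSemiringAction.compHom (C ⊗[k] A)
    (M := (C ⊗[k] A) ≃ₐ[k] (C ⊗[k] A)) (N := G)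
    { toFun := fun g => Algebra.TensorProduct.congr
        (MulSemiringAction.toAlgEquiv k C g) (MulSemiringAction.toAlgEquiv k A g)
      map_one' := by
        apply AlgEquiv.coe_toAlgHom_injective
        ext <;> simp
      map_mul' := fun g h => by
        apply AlgEquiv.coe_toAlgHom_injective
        ext <;> simp [mul_smul] }

theorem diagonalAction_tmul (k G C A : Type*) [CommRing k] [Group G]
    [Ring C] [Algebra k C] [MulSemiringAction G C] [SMulCommClass G k C]
    [Ring A] [Algebra k A] [MulSemiringAction G A] [SMulCommClass G k A]
    (g : G) (c : C) (a : A) :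
    (diagonalAction k G C A).smul g (c ⊗ₜ[k] a) = (g • c) ⊗ₜ[k] (g • a) := rfl

instance diagonalAction_smulCommClass (k G C A : Type*) [CommRing k] [Group G]
    [Ring C] [Algebra k C] [MulSemiringAction G C] [SMulCommClass G k C]
    [Ring A] [Algebra k A] [MulSemiringAction G A] [SMulCommClass G k A] :
    letI := diagonalAction k G C A
    SMulCommClass G k (C ⊗[k] A) := by
  letI := diagonalAction k G C A
  exact ⟨fun g r t => map_smul (Algebra.TensorProduct.congr
        (MulSemiringAction.toAlgEquiv k C g) (MulSemiringAction.toAlgEquiv k A g)) r t⟩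

end Algebra

open Bundle

/-- A bundle of finitely generated projective left `A`-modules on `X`. The first argument of
`TotalSpace` is a phantom. In a local trivialization near `x₀` the model fiber is `Fiber x₀` with
the canonical topology of a finitely generated `A`-module, that is, the module topology. -/
structure ABundle (A : Type v) [NormedRing A] (X : Type w) [TopologicalSpace X] where
  /-- The fiber at a point. -/
  Fiber : X → Type v
  [addCommGroup : ∀ x, AddCommGroup (Fiber x)]
  [module : ∀ x, Module A (Fiber x)]
  [topology : TopologicalSpace (TotalSpace A Fiber)]
  continuous_proj : Continuous fun e : TotalSpace A Fiber => e.proj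
  continuous_smul : Continuous fun p : A × TotalSpace A Fiber =>
    (⟨p.2.proj, p.1 • p.2.snd⟩ : TotalSpace A Fiber)
  finite : ∀ x, Module.Finite A (Fiber x)
  projective : ∀ x, Module.Projective A (Fiber x)
  locally_trivial : ∀ x₀ : X, ∃ U : Set X, IsOpen U ∧ x₀ ∈ U ∧
    ∃ φ : ∀ x : U, Fiber x ≃ₗ[A] Fiber x₀,
      letI : TopologicalSpace (Fiber x₀) := moduleTopology A (Fiber x₀)
      (Continuous fun e : {e : TotalSpace A Fiber // e.proj ∈ U} => φ ⟨e.1.proj, e.2⟩ e.1.snd) ∧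
      (Continuous fun p : U × Fiber x₀ =>
        (⟨(p.1 : X), (φ p.1).symm p.2⟩ : TotalSpace A Fiber))

attribute [instance] ABundle.addCommGroup ABundle.module ABundle.topology

namespace ABundle

variable {A : Type v} [NormedRing A] {X : Type w} [TopologicalSpace X]
  {Y : Type w} [TopologicalSpace Y]

/-- The total space of a bundle. -/
abbrev Total (E : ABundle A X) : Type (max w v) := TotalSpace A E.Fiber

/-- The total space of a Whitney sum, as the fiber product of the total spaces. -/
instance sumTopology (E F : ABundle A X) :
    TopologicalSpace (TotalSpace A fun x => E.Fiber x × F.Fiber x) :=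
  TopologicalSpace.induced
    (fun e => ((⟨e.proj, e.snd.1⟩, ⟨e.proj, e.snd.2⟩) : E.Total × F.Total)) inferInstance

theorem continuous_sum_fst (E F : ABundle A X) :
    Continuous fun e : TotalSpace A (fun x => E.Fiber x × F.Fiber x) =>
      (⟨e.proj, e.snd.1⟩ : E.Total) :=
  (continuous_fst (X := E.Total) (Y := F.Total)).comp
    (continuous_induced_dom (f := fun e : TotalSpace A (fun x => E.Fiber x × F.Fiber x) =>
      ((⟨e.proj, e.snd.1⟩, ⟨e.proj, e.snd.2⟩) : E.Total × F.Total)))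

theorem continuous_sum_snd (E F : ABundle A X) :
    Continuous fun e : TotalSpace A (fun x => E.Fiber x × F.Fiber x) =>
      (⟨e.proj, e.snd.2⟩ : F.Total) :=
  (continuous_snd (X := E.Total) (Y := F.Total)).comp
    (continuous_induced_dom (f := fun e : TotalSpace A (fun x => E.Fiber x × F.Fiber x) =>
      ((⟨e.proj, e.snd.1⟩, ⟨e.proj, e.snd.2⟩) : E.Total × F.Total)))

theorem continuous_sum_mk (E F : ABundle A X) {Z : Type*} [TopologicalSpace Z]
    {b : Z → X} {s : ∀ z, E.Fiber (b z)} {t : ∀ z, F.Fiber (b z)}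
    (hs : Continuous fun z => (⟨b z, s z⟩ : E.Total))
    (ht : Continuous fun z => (⟨b z, t z⟩ : F.Total)) :
    Continuous fun z =>
      (⟨b z, (s z, t z)⟩ : TotalSpace A (fun x => E.Fiber x × F.Fiber x)) :=
  continuous_induced_rng.2 (hs.prodMk ht)

/-- The Whitney sum of two bundles. -/
def sum (E F : ABundle A X) : ABundle A X where
  Fiber x := E.Fiber x × F.Fiber x
  topology := sumTopology E F
  continuous_proj := E.continuous_proj.comp (continuous_sum_fst E F)
  continuous_smul := continuous_sum_mk E F
    (E.continuous_smul.comp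
      (continuous_fst.prodMk ((continuous_sum_fst E F).comp continuous_snd)))
    (F.continuous_smul.comp
      (continuous_fst.prodMk ((continuous_sum_snd E F).comp continuous_snd)))
  finite x := by
    have := E.finite x
    have := F.finite x
    infer_instance
  projective x := by
    have := E.projective x
    have := F.projective x
    infer_instance
  locally_trivial x₀ := by
    obtain ⟨U, hU, hxU, φ, hφ, hφ'⟩ := E.locally_trivial x₀
    obtain ⟨V, hV, hxV, ψ, hψ, hψ'⟩ := F.locally_trivial x₀
    refine ⟨U ∩ V, hU.inter hV, ⟨hxU, hxV⟩, fun x =>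
      (φ ⟨x.1, x.2.1⟩).prodCongr (ψ ⟨x.1, x.2.2⟩), ?_⟩
    let tE : TopologicalSpace (E.Fiber x₀) := moduleTopology A (E.Fiber x₀)
    let tF : TopologicalSpace (F.Fiber x₀) := moduleTopology A (F.Fiber x₀)
    have : IsModuleTopology A (E.Fiber x₀) := ⟨rfl⟩
    have : IsModuleTopology A (F.Fiber x₀) := ⟨rfl⟩
    have key : moduleTopology A (E.Fiber x₀ × F.Fiber x₀) = instTopologicalSpaceProd :=
      (eq_moduleTopology A (E.Fiber x₀ × F.Fiber x₀)).symm
    dsimp only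
    rw [key]
    constructor
    · have h1 : Continuous fun e : {e : TotalSpace A (fun x => E.Fiber x × F.Fiber x) //
          e.proj ∈ U ∩ V} =>
          (⟨⟨e.1.proj, e.1.snd.1⟩, e.2.1⟩ : {e : E.Total // e.proj ∈ U}) :=
        ((continuous_sum_fst E F).comp continuous_subtype_val).subtype_mk _
      have h2 : Continuous fun e : {e : TotalSpace A (fun x => E.Fiber x × F.Fiber x) //
          e.proj ∈ U ∩ V} =>
          (⟨⟨e.1.proj, e.1.snd.2⟩, e.2.2⟩ : {e : F.Total // e.proj ∈ V}) :=
        ((continuous_sum_snd E F).comp continuous_subtype_val).subtype_mk _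
      exact (hφ.comp h1).prodMk (hψ.comp h2)
    · have h1 : Continuous fun p : ↥(U ∩ V) × (E.Fiber x₀ × F.Fiber x₀) =>
          ((⟨p.1.1, p.1.2.1⟩, p.2.1) : U × E.Fiber x₀) :=
        ((continuous_subtype_val.comp continuous_fst).subtype_mk _).prodMk
          (continuous_fst.comp continuous_snd)
      have h2 : Continuous fun p : ↥(U ∩ V) × (E.Fiber x₀ × F.Fiber x₀) =>
          ((⟨p.1.1, p.1.2.2⟩, p.2.2) : V × F.Fiber x₀) :=
        ((continuous_subtype_val.comp continuous_fst).subtype_mk _).prodMk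
          (continuous_snd.comp continuous_snd)
      exact continuous_sum_mk E F (hφ'.comp h1) (hψ'.comp h2)

/-- The topology of the zero bundle: the projection to `X` is a homeomorphism. -/
instance zeroTopology : TopologicalSpace (TotalSpace A fun _ : X => PUnit.{v + 1}) :=
  TopologicalSpace.induced (fun e => e.proj) inferInstance

/-- The zero bundle. -/
def zero (A : Type v) [NormedRing A] (X : Type w) [TopologicalSpace X] : ABundle A X where
  Fiber _ := PUnit.{v + 1}
  topology := zeroTopology
  continuous_proj := continuous_induced_dom
  continuous_smul := continuous_induced_rng.2 (continuous_induced_dom.comp continuous_snd)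
  finite _ := inferInstance
  projective _ := inferInstance
  locally_trivial x₀ := by
    refine ⟨Set.univ, isOpen_univ, Set.mem_univ _, fun _ => LinearEquiv.refl A _, ?_⟩
    let t : TopologicalSpace PUnit.{v + 1} := moduleTopology A PUnit.{v + 1}
    constructor
    · exact @continuous_of_const _ _ _ t _ fun _ _ => rfl
    · exact continuous_induced_rng.2
        (continuous_subtype_val.comp (@continuous_fst _ _ _ t))

/-- The topology of the pullback `f^* E`, as a subspace of `X × E`. -/
instance pullbackTopology (f : C(X, Y)) (E : ABundle A Y) :
    TopologicalSpace (TotalSpace A fun x => E.Fiber (f x)) :=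
  TopologicalSpace.induced
    (fun e => ((e.proj, ⟨f e.proj, e.snd⟩) : X × E.Total)) inferInstance

theorem continuous_pullback_proj (f : C(X, Y)) (E : ABundle A Y) :
    Continuous fun e : TotalSpace A (fun x => E.Fiber (f x)) => e.proj :=
  (continuous_fst (X := X) (Y := E.Total)).comp
    (continuous_induced_dom (f := fun e : TotalSpace A (fun x => E.Fiber (f x)) =>
      ((e.proj, ⟨f e.proj, e.snd⟩) : X × E.Total)))

theorem continuous_pullback_lift (f : C(X, Y)) (E : ABundle A Y) :
    Continuous fun e : TotalSpace A (fun x => E.Fiber (f x)) => (⟨f e.proj, e.snd⟩ : E.Total) :=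
  (continuous_snd (X := X) (Y := E.Total)).comp
    (continuous_induced_dom (f := fun e : TotalSpace A (fun x => E.Fiber (f x)) =>
      ((e.proj, ⟨f e.proj, e.snd⟩) : X × E.Total)))

theorem continuous_pullback_mk (f : C(X, Y)) (E : ABundle A Y) {Z : Type*} [TopologicalSpace Z]
    {b : Z → X} {s : ∀ z, E.Fiber (f (b z))} (hb : Continuous b)
    (hs : Continuous fun z => (⟨f (b z), s z⟩ : E.Total)) :
    Continuous fun z => (⟨b z, s z⟩ : TotalSpace A (fun x => E.Fiber (f x))) :=
  continuous_induced_rng.2 (hb.prodMk hs)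

/-- The pullback of a bundle along a continuous map. -/
def pullback (f : C(X, Y)) (E : ABundle A Y) : ABundle A X where
  Fiber x := E.Fiber (f x)
  topology := pullbackTopology f E
  continuous_proj := continuous_pullback_proj f E
  continuous_smul := continuous_pullback_mk f E
    ((continuous_pullback_proj f E).comp continuous_snd)
    (E.continuous_smul.comp
      (continuous_fst.prodMk ((continuous_pullback_lift f E).comp continuous_snd)))
  finite x := E.finite (f x)
  projective x := E.projective (f x)
  locally_trivial x₀ := by
    obtain ⟨U, hU, hxU, φ, hφ, hφ'⟩ := E.locally_trivial (f x₀)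
    refine ⟨f ⁻¹' U, hU.preimage f.continuous, hxU, fun x => φ ⟨f x, x.2⟩, ?_⟩
    let tE : TopologicalSpace (E.Fiber (f x₀)) := moduleTopology A (E.Fiber (f x₀))
    constructor
    · have h1 : Continuous fun e : {e : TotalSpace A (fun x => E.Fiber (f x)) //
          e.proj ∈ f ⁻¹' U} =>
          (⟨⟨f e.1.proj, e.1.snd⟩, e.2⟩ : {e : E.Total // e.proj ∈ U}) :=
        ((continuous_pullback_lift f E).comp continuous_subtype_val).subtype_mk _
      exact hφ.comp h1
    · have h1 : Continuous fun p : ↥(f ⁻¹' U) × E.Fiber (f x₀) =>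
          ((⟨f p.1.1, p.1.2⟩, p.2) : U × E.Fiber (f x₀)) :=
        ((f.continuous.comp (continuous_subtype_val.comp continuous_fst)).subtype_mk _).prodMk
          continuous_snd
      exact continuous_pullback_mk f E (continuous_subtype_val.comp continuous_fst)
        (hφ'.comp h1)

end ABundle

section Equivariant

variable {G : Type u} [Group G] {A : Type v} [NormedRing A] [NormedAlgebra ℝ A]

/-- Let the discrete group `G` act on `A` by algebra automorphisms through `α`, and on `X`. A
`G`-`A` bundle on `X` is a bundle of finitely generated projective `A`-modules with a continuous
action of `G` on its total space, by additive maps from the fiber at `x` to the fiber at `g • x`,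
such that `g (a • e) = α g a • g e`. For the trivial action `α = 1` this is an `A`-linear
`G`-bundle. -/
structure GBundle (α : G →* (A ≃ₐ[ℝ] A)) (X : Type w) [TopologicalSpace X] [MulAction G X]
    extends ABundle A X where
  /-- The action of a group element from one fiber to another. -/
  act : ∀ (g : G) (x : X), Fiber x →+ Fiber (g • x)
  act_smul : ∀ g x (a : A) (e : Fiber x), act g x (a • e) = α g a • act g x e
  act_one : ∀ x (e : Fiber x), (⟨(1 : G) • x, act 1 x e⟩ : TotalSpace A Fiber) = ⟨x, e⟩
  act_mul : ∀ (g h : G) x (e : Fiber x), (⟨(g * h) • x, act (g * h) x e⟩ : TotalSpace A Fiber) =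
    ⟨g • h • x, act g (h • x) (act h x e)⟩
  continuous_act : ∀ g : G, Continuous fun e : TotalSpace A Fiber =>
    (⟨g • e.proj, act g e.proj e.snd⟩ : TotalSpace A Fiber)

namespace GBundle

variable {α : G →* (A ≃ₐ[ℝ] A)} {X : Type w} [TopologicalSpace X] [MulAction G X]
  {Y : Type w} [TopologicalSpace Y] [MulAction G Y]

/-- An isomorphism of `G`-`A` bundles: a fiberwise `A`-linear, `G`-equivariant homeomorphism over
the identity of `X`. -/
structure Iso (E F : GBundle α X) where
  /-- The map on the fibers. -/
  equiv : ∀ x, E.Fiber x ≃ₗ[A] F.Fiber x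
  continuous_toFun : Continuous fun e : E.Total => (⟨e.proj, equiv e.proj e.snd⟩ : F.Total)
  continuous_invFun :
    Continuous fun e : F.Total => (⟨e.proj, (equiv e.proj).symm e.snd⟩ : E.Total)
  equivariant : ∀ g x (e : E.Fiber x), equiv (g • x) (E.act g x e) = F.act g x (equiv x e)

/-- The identity isomorphism. -/
def Iso.refl (E : GBundle α X) : Iso E E where
  equiv _ := LinearEquiv.refl A _
  continuous_toFun := continuous_id
  continuous_invFun := continuous_id
  equivariant _ _ _ := rfl

/-- The inverse isomorphism. -/
def Iso.symm {E F : GBundle α X} (i : Iso E F) : Iso F E where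
  equiv x := (i.equiv x).symm
  continuous_toFun := i.continuous_invFun
  continuous_invFun := i.continuous_toFun
  equivariant g x e := by
    rw [LinearEquiv.symm_apply_eq, i.equivariant, LinearEquiv.apply_symm_apply]

/-- The composite of two isomorphisms. -/
def Iso.trans {E F H : GBundle α X} (i : Iso E F) (j : Iso F H) : Iso E H where
  equiv x := (i.equiv x).trans (j.equiv x)
  continuous_toFun := j.continuous_toFun.comp i.continuous_toFun
  continuous_invFun := i.continuous_invFun.comp j.continuous_invFun
  equivariant g x e := by simp [i.equivariant, j.equivariant]

instance isoSetoid (α : G →* (A ≃ₐ[ℝ] A)) (X : Type w) [TopologicalSpace X] [MulAction G X] :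
    Setoid (GBundle α X) where
  r E F := Nonempty (Iso E F)
  iseqv := ⟨fun E => ⟨.refl E⟩, fun ⟨i⟩ => ⟨i.symm⟩, fun ⟨i⟩ ⟨j⟩ => ⟨i.trans j⟩⟩

theorem mk_prod_eq {E F : ABundle A X} {x y : X} {e : E.Fiber x × F.Fiber x}
    {e' : E.Fiber y × F.Fiber y}
    (h₁ : (⟨x, e.1⟩ : E.Total) = ⟨y, e'.1⟩) (h₂ : (⟨x, e.2⟩ : F.Total) = ⟨y, e'.2⟩) :
    (⟨x, e⟩ : TotalSpace A fun x => E.Fiber x × F.Fiber x) = ⟨y, e'⟩ := by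
  obtain rfl : x = y := congrArg TotalSpace.proj h₁
  rw [TotalSpace.mk_inj] at h₁ h₂
  rw [Prod.ext h₁ h₂]

/-- The Whitney sum of two `G`-`A` bundles. -/
def sum (E F : GBundle α X) : GBundle α X where
  toABundle := E.toABundle.sum F.toABundle
  act g x := (E.act g x).prodMap (F.act g x)
  act_smul g x a e := Prod.ext (E.act_smul g x a e.1) (F.act_smul g x a e.2)
  act_one x e := mk_prod_eq (E.act_one x e.1) (F.act_one x e.2)
  act_mul g h x e := mk_prod_eq (E.act_mul g h x e.1) (F.act_mul g h x e.2)
  continuous_act g := ABundle.continuous_sum_mk E.toABundle F.toABundle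
    ((E.continuous_act g).comp (ABundle.continuous_sum_fst E.toABundle F.toABundle))
    ((F.continuous_act g).comp (ABundle.continuous_sum_snd E.toABundle F.toABundle))

/-- The zero bundle. The action of `G` on `X` is continuous, hence so is its action here. -/
def zero (α : G →* (A ≃ₐ[ℝ] A)) (X : Type w) [TopologicalSpace X] [MulAction G X]
    [ContinuousConstSMul G X] : GBundle α X where
  toABundle := ABundle.zero A X
  act _ _ := 0
  act_smul _ _ _ _ := rfl
  act_one x _ := TotalSpace.ext (one_smul G x) HEq.rfl
  act_mul g h x _ := TotalSpace.ext (mul_smul g h x) HEq.rfl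
  continuous_act g := continuous_induced_rng.2
    ((continuous_const_smul g).comp continuous_induced_dom)

/-- The sum of two isomorphisms. -/
def Iso.sum {E E' F F' : GBundle α X} (i : Iso E E') (j : Iso F F') :
    Iso (E.sum F) (E'.sum F') where
  equiv x := (i.equiv x).prodCongr (j.equiv x)
  continuous_toFun := ABundle.continuous_sum_mk E'.toABundle F'.toABundle
    (i.continuous_toFun.comp (ABundle.continuous_sum_fst E.toABundle F.toABundle))
    (j.continuous_toFun.comp (ABundle.continuous_sum_snd E.toABundle F.toABundle))
  continuous_invFun := ABundle.continuous_sum_mk E.toABundle F.toABundle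
    (i.continuous_invFun.comp (ABundle.continuous_sum_fst E'.toABundle F'.toABundle))
    (j.continuous_invFun.comp (ABundle.continuous_sum_snd E'.toABundle F'.toABundle))
  equivariant g x e := Prod.ext (i.equivariant g x e.1) (j.equivariant g x e.2)

/-- Commutativity of the Whitney sum. -/
def Iso.sumComm (E F : GBundle α X) : Iso (E.sum F) (F.sum E) where
  equiv _ := LinearEquiv.prodComm A _ _
  continuous_toFun := ABundle.continuous_sum_mk F.toABundle E.toABundle
    (ABundle.continuous_sum_snd E.toABundle F.toABundle)
    (ABundle.continuous_sum_fst E.toABundle F.toABundle)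
  continuous_invFun := ABundle.continuous_sum_mk E.toABundle F.toABundle
    (ABundle.continuous_sum_snd F.toABundle E.toABundle)
    (ABundle.continuous_sum_fst F.toABundle E.toABundle)
  equivariant _ _ _ := rfl

/-- Associativity of the Whitney sum. -/
def Iso.sumAssoc (E F H : GBundle α X) : Iso ((E.sum F).sum H) (E.sum (F.sum H)) where
  equiv _ := LinearEquiv.prodAssoc A _ _ _
  continuous_toFun :=
    have h := ABundle.continuous_sum_fst (E.sum F).toABundle H.toABundle
    ABundle.continuous_sum_mk E.toABundle (F.sum H).toABundle
      ((ABundle.continuous_sum_fst E.toABundle F.toABundle).comp h)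
      (ABundle.continuous_sum_mk F.toABundle H.toABundle
        ((ABundle.continuous_sum_snd E.toABundle F.toABundle).comp h)
        (ABundle.continuous_sum_snd (E.sum F).toABundle H.toABundle))
  continuous_invFun :=
    have h := ABundle.continuous_sum_snd E.toABundle (F.sum H).toABundle
    ABundle.continuous_sum_mk (E.sum F).toABundle H.toABundle
      (ABundle.continuous_sum_mk E.toABundle F.toABundle
        (ABundle.continuous_sum_fst E.toABundle (F.sum H).toABundle)
        ((ABundle.continuous_sum_fst F.toABundle H.toABundle).comp h))
      ((ABundle.continuous_sum_snd F.toABundle H.toABundle).comp h)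
  equivariant _ _ _ := rfl

/-- The zero bundle is neutral for the Whitney sum. -/
def Iso.zeroSum [ContinuousConstSMul G X] (E : GBundle α X) : Iso ((zero α X).sum E) E where
  equiv _ :=
    { toFun := fun e => e.2
      invFun := fun e => (PUnit.unit, e)
      left_inv := fun _ => rfl
      right_inv := fun _ => rfl
      map_add' := fun _ _ => rfl
      map_smul' := fun _ _ => rfl }
  continuous_toFun := ABundle.continuous_sum_snd (zero α X).toABundle E.toABundle
  continuous_invFun := ABundle.continuous_sum_mk (zero α X).toABundle E.toABundle
    (continuous_induced_rng.2 E.continuous_proj) continuous_id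
  equivariant _ _ _ := rfl

/-- The transport of a fiber along an equality of base points. -/
def castFiber (E : ABundle A Y) {y y' : Y} (h : y = y') : E.Fiber y ≃ₗ[A] E.Fiber y' :=
  h ▸ LinearEquiv.refl A (E.Fiber y)

theorem mk_castFiber (E : ABundle A Y) {y y' : Y} (h : y = y') (e : E.Fiber y) :
    (⟨y', castFiber E h e⟩ : E.Total) = ⟨y, e⟩ := by
  subst h
  rfl

theorem mk_pullback_eq {f : C(X, Y)} {E : ABundle A Y} {x x' : X} {e : E.Fiber (f x)}
    {e' : E.Fiber (f x')} (h : x = x') (h' : (⟨f x, e⟩ : E.Total) = ⟨f x', e'⟩) :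
    (⟨x, e⟩ : TotalSpace A fun x => E.Fiber (f x)) = ⟨x', e'⟩ := by
  subst h
  rw [TotalSpace.mk_inj] at h'
  rw [h']

theorem mk_act_congr (E : GBundle α Y) (g : G) {p q : E.Total} (h : p = q) :
    (⟨g • p.proj, E.act g p.proj p.snd⟩ : E.Total) = ⟨g • q.proj, E.act g q.proj q.snd⟩ := by
  rw [h]

/-- The pullback of a `G`-`A` bundle along a continuous equivariant map. -/
def pullback [ContinuousConstSMul G X] (f : C(X, Y)) (hf : ∀ (g : G) x, f (g • x) = g • f x)
    (E : GBundle α Y) : GBundle α X where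
  toABundle := E.toABundle.pullback f
  act g x := (castFiber E.toABundle (hf g x).symm).toLinearMap.toAddMonoidHom.comp (E.act g (f x))
  act_smul g x a e :=
    (congrArg (castFiber E.toABundle (hf g x).symm) (E.act_smul g (f x) a e)).trans
      (map_smul (castFiber E.toABundle (hf g x).symm) _ _)
  act_one x e := mk_pullback_eq (one_smul G x)
    ((mk_castFiber E.toABundle (hf 1 x).symm _).trans (E.act_one (f x) e))
  act_mul g h x e := mk_pullback_eq (mul_smul g h x)
    ((mk_castFiber E.toABundle (hf (g * h) x).symm _).trans <|
      (E.act_mul g h (f x) e).trans <|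
        (mk_act_congr E g (mk_castFiber E.toABundle (hf h x).symm (E.act h (f x) e)).symm).trans
          (mk_castFiber E.toABundle (hf g (h • x)).symm _).symm)
  continuous_act g := by
    refine ABundle.continuous_pullback_mk f E.toABundle
      ((continuous_const_smul g).comp (ABundle.continuous_pullback_proj f E.toABundle)) ?_
    refine ((E.continuous_act g).comp (ABundle.continuous_pullback_lift f E.toABundle)).congr ?_
    exact fun e => (mk_castFiber E.toABundle (hf g e.proj).symm _).symm

theorem equiv_castFiber {E F : ABundle A Y} (φ : ∀ y, E.Fiber y ≃ₗ[A] F.Fiber y) {y y' : Y}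
    (h : y = y') (e : E.Fiber y) : φ y' (castFiber E h e) = castFiber F h (φ y e) := by
  subst h
  rfl

theorem castFiber_sum {E F : ABundle A Y} {y y' : Y} (h : y = y') (e : (E.sum F).Fiber y) :
    castFiber (E.sum F) h e = (castFiber E h e.1, castFiber F h e.2) := by
  subst h
  rfl

variable [ContinuousConstSMul G X]

/-- The pullback of an isomorphism. -/
def Iso.pullback (f : C(X, Y)) (hf : ∀ (g : G) x, f (g • x) = g • f x) {E F : GBundle α Y}
    (i : Iso E F) : Iso (E.pullback f hf) (F.pullback f hf) where
  equiv x := i.equiv (f x)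
  continuous_toFun := ABundle.continuous_pullback_mk f F.toABundle
    (ABundle.continuous_pullback_proj f E.toABundle)
    (i.continuous_toFun.comp (ABundle.continuous_pullback_lift f E.toABundle))
  continuous_invFun := ABundle.continuous_pullback_mk f E.toABundle
    (ABundle.continuous_pullback_proj f F.toABundle)
    (i.continuous_invFun.comp (ABundle.continuous_pullback_lift f F.toABundle))
  equivariant g x e := (equiv_castFiber i.equiv (hf g x).symm _).trans
    (congrArg (castFiber F.toABundle (hf g x).symm) (i.equivariant g (f x) e))

/-- Pullback commutes with Whitney sums. -/
def Iso.pullbackSum (f : C(X, Y)) (hf : ∀ (g : G) x, f (g • x) = g • f x) (E F : GBundle α Y) :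
    Iso ((E.sum F).pullback f hf) ((E.pullback f hf).sum (F.pullback f hf)) where
  equiv x := LinearEquiv.refl A (E.Fiber (f x) × F.Fiber (f x))
  continuous_toFun :=
    have h := ABundle.continuous_pullback_proj f (E.sum F).toABundle
    have h' := ABundle.continuous_pullback_lift f (E.sum F).toABundle
    ABundle.continuous_sum_mk (E.pullback f hf).toABundle (F.pullback f hf).toABundle
      (ABundle.continuous_pullback_mk f E.toABundle h
        ((ABundle.continuous_sum_fst E.toABundle F.toABundle).comp h'))
      (ABundle.continuous_pullback_mk f F.toABundle h
        ((ABundle.continuous_sum_snd E.toABundle F.toABundle).comp h'))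
  continuous_invFun :=
    have h := ABundle.continuous_sum_fst (E.pullback f hf).toABundle (F.pullback f hf).toABundle
    have h' := ABundle.continuous_sum_snd (E.pullback f hf).toABundle (F.pullback f hf).toABundle
    ABundle.continuous_pullback_mk f (E.sum F).toABundle
      ((ABundle.continuous_pullback_proj f E.toABundle).comp h)
      (ABundle.continuous_sum_mk E.toABundle F.toABundle
        ((ABundle.continuous_pullback_lift f E.toABundle).comp h)
        ((ABundle.continuous_pullback_lift f F.toABundle).comp h'))
  equivariant g x _ := castFiber_sum (hf g x).symm _

/-- Pullback preserves the zero bundle. -/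
def Iso.pullbackZero [ContinuousConstSMul G Y] (f : C(X, Y))
    (hf : ∀ (g : G) x, f (g • x) = g • f x) :
    Iso ((GBundle.zero α Y).pullback f hf) (GBundle.zero α X) where
  equiv _ := LinearEquiv.refl A PUnit.{v + 1}
  continuous_toFun := continuous_induced_rng.2
    (ABundle.continuous_pullback_proj f (ABundle.zero A Y))
  continuous_invFun := ABundle.continuous_pullback_mk f (ABundle.zero A Y)
    continuous_induced_dom
    (continuous_induced_rng.2 (f.continuous.comp continuous_induced_dom))
  equivariant _ _ _ := rfl

end GBundle

/-- Isomorphism classes of `G`-`A` bundles. -/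
def IsoClass (α : G →* (A ≃ₐ[ℝ] A)) (X : Type w) [TopologicalSpace X] [MulAction G X] :
    Type (max u w (v + 1)) :=
  Quotient (GBundle.isoSetoid α X)

instance IsoClass.instAdd (α : G →* (A ≃ₐ[ℝ] A)) (X : Type w) [TopologicalSpace X]
    [MulAction G X] : Add (IsoClass α X) :=
  ⟨Quotient.map₂ GBundle.sum fun _ _ ⟨i⟩ _ _ ⟨j⟩ => ⟨i.sum j⟩⟩

instance IsoClass.instZero (α : G →* (A ≃ₐ[ℝ] A)) (X : Type w) [TopologicalSpace X]
    [MulAction G X] [ContinuousConstSMul G X] : Zero (IsoClass α X) :=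
  ⟨Quotient.mk _ (GBundle.zero α X)⟩

/-- Isomorphism classes form a commutative monoid under the Whitney sum. -/
instance IsoClass.addCommMonoid (α : G →* (A ≃ₐ[ℝ] A)) (X : Type w) [TopologicalSpace X]
    [MulAction G X] [ContinuousConstSMul G X] : AddCommMonoid (IsoClass α X) where
  add_assoc a b c := by
    induction a, b, c using Quotient.inductionOn₃ with
    | _ E F H => exact Quotient.sound ⟨.sumAssoc E F H⟩
  add_comm a b := by
    induction a, b using Quotient.inductionOn₂ with
    | _ E F => exact Quotient.sound ⟨.sumComm E F⟩
  zero_add a := by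
    induction a using Quotient.inductionOn with
    | _ E => exact Quotient.sound ⟨.zeroSum E⟩
  add_zero a := by
    induction a using Quotient.inductionOn with
    | _ E => exact Quotient.sound ⟨(GBundle.Iso.sumComm _ _).trans (.zeroSum E)⟩
  nsmul := nsmulRec

/-- The pullback of isomorphism classes along a continuous equivariant map. -/
def IsoClass.pullback (α : G →* (A ≃ₐ[ℝ] A)) {X Y : Type w} [TopologicalSpace X] [MulAction G X]
    [ContinuousConstSMul G X] [TopologicalSpace Y] [MulAction G Y] [ContinuousConstSMul G Y]
    (f : C(X, Y)) (hf : ∀ (g : G) x, f (g • x) = g • f x) : IsoClass α Y →+ IsoClass α X where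
  toFun := Quotient.map (GBundle.pullback f hf) fun _ _ ⟨i⟩ => ⟨i.pullback f hf⟩
  map_zero' := Quotient.sound ⟨.pullbackZero f hf⟩
  map_add' a b := by
    induction a, b using Quotient.inductionOn₂ with
    | _ E F => exact Quotient.sound ⟨.pullbackSum f hf E F⟩

/-- The group `K_G^A(X)`: the Grothendieck group of the additive category of `G`-`A` bundles on
`X`, where `G` acts on `A` through `α`. -/
abbrev KGroup (α : G →* (A ≃ₐ[ℝ] A)) (X : Type w) [TopologicalSpace X] [MulAction G X]
    [ContinuousConstSMul G X] : Type (max u w (v + 1)) :=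
  Algebra.GrothendieckAddGroup (IsoClass α X)

/-- The map `f^* : K_G^A(Y) → K_G^A(X)` induced by a continuous equivariant map `f : X → Y`. -/
noncomputable def KGroup.pullback (α : G →* (A ≃ₐ[ℝ] A)) {X Y : Type w} [TopologicalSpace X]
    [MulAction G X] [ContinuousConstSMul G X] [TopologicalSpace Y] [MulAction G Y]
    [ContinuousConstSMul G Y] (f : C(X, Y)) (hf : ∀ (g : G) x, f (g • x) = g • f x) :
    KGroup α Y →+ KGroup α X :=
  Algebra.GrothendieckAddGroup.lift
    (Algebra.GrothendieckAddGroup.of.comp (IsoClass.pullback α f hf))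

/-- The equivariant `K`-theories of `A`-bundles for two actions of `G` on `A` are isomorphic:
there are isomorphisms `K_G^{A,α}(X) ≃ K_G^{A,β}(X)` for all `G`-spaces `X`, natural in `X`. -/
def KTheoryIso (α β : G →* (A ≃ₐ[ℝ] A)) : Prop :=
  ∃ Φ : ∀ (X : Type w) [TopologicalSpace X] [MulAction G X] [ContinuousConstSMul G X],
      KGroup α X ≃+ KGroup β X,
    ∀ (X Y : Type w) [TopologicalSpace X] [MulAction G X] [ContinuousConstSMul G X]
      [TopologicalSpace Y] [MulAction G Y] [ContinuousConstSMul G Y]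
      (f : C(X, Y)) (hf : ∀ (g : G) x, f (g • x) = g • f x) (ξ : KGroup α Y),
      Φ X (KGroup.pullback α f hf ξ) = KGroup.pullback β f hf (Φ Y ξ)

end Equivariant

end EquivariantBundles

/-! An inner action can be absorbed into units of `A`. In the twisted group ring, conjugation by `g`
acts on `A` as conjugation by `x g`, so `(x g)⁻¹ · g` centralizes `A`; since `x` is a homomorphism,
these elements form a copy of `G`. Taking them as the new basis gives the ordinary group ring. The
same substitution proves the tensor statement: pairing `g` with `x g` in the factor `A` leaves `G`
acting on `C` alone. The explicit formulas `tensorInner_single` and `tensorInnerInv_single_tmul`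
show that the two maps are inverse.

For bundles, let the action of `g` on `E` be replaced by `u g • g`. If `β g` is `α g` followed by
conjugation by `u g`, this turns `α`-semilinear maps into `β`-semilinear ones, and it is again an
action if `u` is a 1-cocycle for `α`. For inner actions through `x` and `y`, the choice `u g = y g *
(x g)⁻¹` works (`IsTwist.of_inner`). Twisting leaves the underlying bundle and its topology
unchanged, is undone by `u⁻¹`, and commutes with sums and pullbacks. It therefore gives natural
isomorphisms of monoids of isomorphism classes, hence of Grothendieck groups
(`kTheoryIso_of_isTwist`). -/

namespace SkewMonoidAlgebra

variable {k G A C : Type*} [CommRing k] [Group G]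

/-! ### Twisted group rings of inner actions -/

section Ring

variable [Ring A] [MulSemiringAction G A]

/-- If `g • a = x g * a * (x g)⁻¹`, then `g ↦ (x g)⁻¹ · g` is multiplicative in the twisted group
ring. -/
noncomputable def untwist (x : G →* Aˣ)
    (hx : ∀ (g : G) (a : A), g • a = (x g : A) * a * ((x g)⁻¹ : Aˣ)) :
    G →* SkewMonoidAlgebra A G where
  toFun g := single g (((x g)⁻¹ : Aˣ) : A)
  map_one' := by simp
  map_mul' g h := by simp [single_mul_single, hx, ← mul_assoc]

/-- The elements `(x g)⁻¹ · g` commute with `A`. -/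
theorem untwist_commute (x : G →* Aˣ)
    (hx : ∀ (g : G) (a : A), g • a = (x g : A) * a * ((x g)⁻¹ : Aˣ)) (a : A) (g : G) :
    Commute (single 1 a) (untwist x hx g) := by
  simp [Commute, SemiconjBy, untwist, single_mul_single, hx, ← mul_assoc]

/-- For an action by inner automorphisms through `x`, the twisted group ring is the group ring. -/
noncomputable def innerEquiv (x : G →* Aˣ)
    (hx : ∀ (g : G) (a : A), g • a = (x g : A) * a * ((x g)⁻¹ : Aˣ)) :
    SkewMonoidAlgebra A G ≃+* MonoidAlgebra A G :=
  RingEquiv.ofRingHom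
    (liftNCRingHom MonoidAlgebra.singleOneRingHom
      { toFun := fun g => MonoidAlgebra.single g (x g : A)
        map_one' := by simp [MonoidAlgebra.one_def]
        map_mul' := fun g h => by simp [MonoidAlgebra.single_mul_single] }
      -- Conjugation by the unit `x g · g` of `A[G]` induces on `A` exactly the given action.
      (fun {a g} => by simp [MonoidAlgebra.single_mul_single, hx]))
    (MonoidAlgebra.liftNCRingHom singleOneRingHom (untwist x hx) (untwist_commute x hx))
    (by
      apply MonoidAlgebra.ringHom_ext <;> intro a <;>
        simp [MonoidAlgebra.liftNCRingHom, liftNCRingHom, singleOneRingHom, untwist,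
          MonoidAlgebra.single_mul_single])
    (by
      -- As an additive map the composite is determined on the elements `a · g`, where the factors
      -- `x g` and `(x g)⁻¹` cancel.
      apply RingHom.coe_addMonoidHom_injective
      apply addHom_ext
      intro g a
      simp [MonoidAlgebra.liftNCRingHom, liftNCRingHom, singleOneRingHom, untwist,
        MonoidAlgebra.single_mul_single, single_mul_single])

theorem innerEquiv_single_one (x : G →* Aˣ)
    (hx : ∀ (g : G) (a : A), g • a = (x g : A) * a * ((x g)⁻¹ : Aˣ)) (a : A) :
    innerEquiv x hx (single 1 a) = MonoidAlgebra.single 1 a := by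
  simp [innerEquiv, liftNCRingHom, MonoidAlgebra.single_mul_single]

end Ring

/-! ### Twisted group rings of tensor products -/

section Tensor

variable [Ring A] [Algebra k A] [MulSemiringAction G A] [SMulCommClass G k A]
  [Ring C] [Algebra k C] [MulSemiringAction G C] [SMulCommClass G k C]

/-- The inclusion of the coefficients in a twisted group ring, as an algebra homomorphism. -/
noncomputable def singleOneAlgHom (k G C : Type*) [CommRing k] [Group G] [Ring C] [Algebra k C]
    [MulSemiringAction G C] [SMulCommClass G k C] : C →ₐ[k] SkewMonoidAlgebra C G where
  __ := singleOneRingHom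
  commutes' _ := rfl

@[simp]
theorem singleOneAlgHom_apply (c : C) : singleOneAlgHom k G C c = single 1 c := rfl

/-- Every `c · g` factors as `(c · 1) * (1 · g)`, so the coefficients and the group elements
generate the ring. -/
theorem algHom_ext_single {B : Type*} [Ring B] [Algebra k B]
    {φ ψ : SkewMonoidAlgebra C G →ₐ[k] B}
    (h₁ : φ.comp (singleOneAlgHom k G C) = ψ.comp (singleOneAlgHom k G C))
    (h₂ : ∀ g : G, φ (single g 1) = ψ (single g 1)) : φ = ψ := by
  apply AlgHom.coe_ringHom_injective
  apply RingHom.coe_addMonoidHom_injective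
  apply addHom_ext
  intro g c
  have h : (single g c : SkewMonoidAlgebra C G) = single 1 c * single g 1 := by
    simp [single_mul_single]
  have h₁' := DFunLike.congr_fun h₁ c
  simp only [AlgHom.comp_apply, singleOneAlgHom_apply] at h₁'
  change φ (single g c) = ψ (single g c)
  rw [h, map_mul, map_mul, h₁', h₂]

attribute [local instance] EquivariantBundles.diagonalAction

theorem smul_tmul_diagonal (g : G) (c : C) (a : A) :
    g • (c ⊗ₜ[k] a) = (g • c) ⊗ₜ[k] (g • a) := rfl

/-- The algebra homomorphism `(C ⊗ A) ⋊ G → (C ⋊ G) ⊗ A` which is the identity on `C ⊗ A` and maps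
`g` to `g ⊗ x g`. -/
noncomputable def tensorInner (x : G →* Aˣ)
    (hx : ∀ (g : G) (a : A), g • a = (x g : A) * a * ((x g)⁻¹ : Aˣ)) :
    SkewMonoidAlgebra (C ⊗[k] A) G →ₐ[k] SkewMonoidAlgebra C G ⊗[k] A :=
  liftNCAlgHom (Algebra.TensorProduct.map (singleOneAlgHom k G C) (AlgHom.id k A))
    { toFun := fun g => single g 1 ⊗ₜ (x g : A)
      map_one' := by simp [Algebra.TensorProduct.one_def]
      map_mul' := fun g h => by simp [single_mul_single] }
    -- The commutation relation is additive in the coefficient `t`, so pure tensors suffice.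
    (fun {t g} => by
      induction t with
      | zero => simp
      | add s t hs ht => rw [smul_add, map_add, map_add, add_mul, mul_add, hs, ht]
      | tmul c a => simp [smul_tmul_diagonal, single_mul_single, hx])

/-- The unit stands to the right of `a` because the group element stands to the right of its
coefficient: `(c ⊗ a) · g` is sent to `(c ⊗ a) * (g ⊗ x g)`. -/
theorem tensorInner_single (x : G →* Aˣ)
    (hx : ∀ (g : G) (a : A), g • a = (x g : A) * a * ((x g)⁻¹ : Aˣ)) (g : G) (c : C) (a : A) :
    tensorInner (k := k) x hx (single g (c ⊗ₜ a)) = single g c ⊗ₜ (a * x g) := by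
  simp [tensorInner, liftNCAlgHom, liftNCRingHom, single_mul_single]

/-- The algebra homomorphism `(C ⋊ G) ⊗ A → (C ⊗ A) ⋊ G` which is the identity on `C` and `A` and
maps `g` to `(1 ⊗ (x g)⁻¹) · g`. -/
noncomputable def tensorInnerInv (x : G →* Aˣ)
    (hx : ∀ (g : G) (a : A), g • a = (x g : A) * a * ((x g)⁻¹ : Aˣ)) :
    SkewMonoidAlgebra C G ⊗[k] A →ₐ[k] SkewMonoidAlgebra (C ⊗[k] A) G :=
  Algebra.TensorProduct.lift
    (liftNCAlgHom ((singleOneAlgHom k G (C ⊗[k] A)).comp Algebra.TensorProduct.includeLeft)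
      { toFun := fun g => single g (1 ⊗ₜ (((x g)⁻¹ : Aˣ) : A))
        map_one' := by simp [← Algebra.TensorProduct.one_def]
        map_mul' := fun g h => by
          simp [single_mul_single, smul_tmul_diagonal, hx, ← mul_assoc] }
      (fun {c g} => by simp [single_mul_single, smul_tmul_diagonal]))
    ((singleOneAlgHom k G (C ⊗[k] A)).comp Algebra.TensorProduct.includeRight)
    -- The images of `C ⋊ G` and `A` must commute. Moving `1 ⊗ a` to the left past `g` conjugates
    -- `a` by `x g`, and the coefficient `(x g)⁻¹` undoes this.
    (fun f a => by
      induction f using induction_on with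
      | zero => simp
      | single g c =>
        simp [Commute, SemiconjBy, liftNCAlgHom, liftNCRingHom, single_mul_single,
          smul_tmul_diagonal, hx, ← mul_assoc]
      | add f f' hf hf' => rw [map_add]; exact hf.add_left hf')

/-- Since `a` commutes with the image of `c · g`, it can be moved to the left of `(x g)⁻¹`. The
result is right multiplication by `(x g)⁻¹`, opposite to `tensorInner_single`. -/
theorem tensorInnerInv_single_tmul (x : G →* Aˣ)
    (hx : ∀ (g : G) (a : A), g • a = (x g : A) * a * ((x g)⁻¹ : Aˣ)) (g : G) (c : C) (a : A) :
    tensorInnerInv (k := k) x hx (single g c ⊗ₜ a) = single g (c ⊗ₜ (a * ((x g)⁻¹ : Aˣ))) := by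
  simp [tensorInnerInv, liftNCAlgHom, liftNCRingHom, single_mul_single, smul_tmul_diagonal, hx,
    ← mul_assoc]

/-- If `G` acts on `A` by inner automorphisms through `x`, then `(C ⊗ A) ⋊ G ≃ (C ⋊ G) ⊗ A`. -/
noncomputable def tensorInnerEquiv (x : G →* Aˣ)
    (hx : ∀ (g : G) (a : A), g • a = (x g : A) * a * ((x g)⁻¹ : Aˣ)) :
    SkewMonoidAlgebra (C ⊗[k] A) G ≃ₐ[k] SkewMonoidAlgebra C G ⊗[k] A :=
  AlgEquiv.ofAlgHom (tensorInner x hx) (tensorInnerInv x hx)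
    (by
      apply Algebra.TensorProduct.ext
      · apply algHom_ext_single
        · ext c
          simp [tensorInnerInv_single_tmul, tensorInner_single]
        · intro g
          simp [tensorInnerInv_single_tmul, tensorInner_single]
      · ext a
        -- The unit has to stay in the form `single 1 1` for the explicit formulas to apply.
        simp [one_def, tensorInnerInv_single_tmul, tensorInner_single, -single_one_one])
    (by
      apply algHom_ext_single
      · apply Algebra.TensorProduct.ext <;> apply AlgHom.ext <;> intro a <;>
          simp [tensorInner_single, tensorInnerInv_single_tmul, -single_one_one]
      · intro g
        simp [Algebra.TensorProduct.one_def, tensorInnerInv_single_tmul, tensorInner_single])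

end Tensor

end SkewMonoidAlgebra

/-! ### Twists of an action by a cocycle -/

namespace EquivariantBundles

open Bundle

/-- The action laws are equalities in the total space, between vectors whose fibers are only
propositionally equal; this lets a scalar act on both sides. -/
theorem ABundle.mk_smul_congr {A : Type v} [NormedRing A] {X : Type w} [TopologicalSpace X]
    (E : ABundle A X) (a : A) {p q : E.Total} (h : p = q) :
    (⟨p.proj, a • p.snd⟩ : E.Total) = ⟨q.proj, a • q.snd⟩ := by
  rw [h]

section Twist

variable {G : Type u} [Group G] {A : Type v} [NormedRing A] [NormedAlgebra ℝ A]

/-- `u` is a `1`-cocycle for the action `α`, and `β` is the action `α` twisted by `u`. -/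
structure IsTwist (α β : G →* (A ≃ₐ[ℝ] A)) (u : G → Aˣ) : Prop where
  map_mul : ∀ g h, (u (g * h) : A) = u g * α g (u h)
  twist : ∀ g a, β g a * u g = u g * α g a

namespace IsTwist

variable {α β : G →* (A ≃ₐ[ℝ] A)} {u : G → Aˣ}

theorem map_one (hu : IsTwist α β u) : u 1 = 1 := by
  have h := hu.map_mul 1 1
  rw [mul_one, _root_.map_one, AlgEquiv.one_apply] at h
  exact mul_eq_left.1 (Units.ext h.symm)

/-- Rewriting `β g` through `α g` turns the cocycle identity for `u⁻¹` into the inverse of the one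
for `u`. -/
theorem symm (hu : IsTwist α β u) : IsTwist β α fun g => (u g)⁻¹ where
  map_mul g h := by
    have h₁ : β g ((u h)⁻¹ : Aˣ) = u g * α g ((u h)⁻¹ : Aˣ) * ((u g)⁻¹ : Aˣ) :=
      (Units.eq_mul_inv_iff_mul_eq _).2 (hu.twist g _)
    have h₂ : (α g ((u h)⁻¹ : Aˣ)) * ((u g)⁻¹ : Aˣ) * u (g * h) = 1 := by
      rw [hu.map_mul, mul_assoc, Units.inv_mul_cancel_left, ← _root_.map_mul, Units.inv_mul,
        _root_.map_one]
    rw [h₁, mul_assoc, Units.inv_mul_cancel_left]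
    exact Units.inv_eq_of_mul_eq_one_left h₂
  twist g a := by
    rw [Units.eq_inv_mul_iff_mul_eq, ← mul_assoc, ← hu.twist, Units.mul_inv_cancel_right]

/-- Two inner actions differ by a twist. -/
theorem of_inner (x y : G →* Aˣ) (hx : ∀ (g : G) (a : A), α g a = (x g : A) * a * ((x g)⁻¹ : Aˣ))
    (hy : ∀ (g : G) (a : A), β g a = (y g : A) * a * ((y g)⁻¹ : Aˣ)) :
    IsTwist α β fun g => y g * (x g)⁻¹ where
  -- Both sides equal `y g * y h * (x h)⁻¹ * (x g)⁻¹`: on the right, `α g` conjugates by `x g`,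
  -- which cancels the inner `(x g)⁻¹`.
  map_mul g h := by simp [hx, mul_assoc]
  twist g a := by simp [hx, hy, mul_assoc]

end IsTwist

/-! ### Twisting equivariant bundles -/

namespace GBundle

variable {α β : G →* (A ≃ₐ[ℝ] A)} {u : G → Aˣ}
  {X : Type w} [TopologicalSpace X] [MulAction G X]
  {Y : Type w} [TopologicalSpace Y] [MulAction G Y]

/-- The bundle `E` with the action of `g` replaced by `u g • g`. -/
def twist (hu : IsTwist α β u) (E : GBundle α X) : GBundle β X where
  toABundle := E.toABundle
  act g x := (DistribSMul.toAddMonoidHom (E.Fiber (g • x)) (u g : A)).comp (E.act g x)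
  act_smul g x a e := by
    simp only [AddMonoidHom.comp_apply, DistribSMul.toAddMonoidHom_apply, E.act_smul, smul_smul,
      hu.twist]
  act_one x e := by
    refine Eq.trans ?_ (E.act_one x e)
    simp [hu.map_one]
  act_mul g h x e := by
    -- Moving `u h` out through the semilinear action of `g` produces `u g * α g (u h)`, which the
    -- cocycle identity matches with `u (g * h)`.
    refine (ABundle.mk_smul_congr E.toABundle _ (E.act_mul g h x e)).trans ?_
    simp only [AddMonoidHom.comp_apply, DistribSMul.toAddMonoidHom_apply, E.act_smul, smul_smul,
      hu.map_mul]
  continuous_act g :=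
    E.continuous_smul.comp (continuous_const.prodMk (E.continuous_act g))

/-- Twisting an isomorphism. -/
def Iso.twist (hu : IsTwist α β u) {E F : GBundle α X} (i : Iso E F) :
    Iso (E.twist hu) (F.twist hu) where
  equiv := i.equiv
  continuous_toFun := i.continuous_toFun
  continuous_invFun := i.continuous_invFun
  equivariant g x e :=
    ((i.equiv (g • x)).map_smul _ _).trans (congrArg ((u g : A) • ·) (i.equivariant g x e))

/-- Twisting by `u` and by `u⁻¹` are inverse to each other. -/
def Iso.twistTwist {u' : G → Aˣ} (hu : IsTwist α β u) (hu' : IsTwist β α u')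
    (h : ∀ g, u' g * u g = 1) (E : GBundle α X) : Iso ((E.twist hu).twist hu') E where
  equiv _ := LinearEquiv.refl A _
  continuous_toFun := continuous_id
  continuous_invFun := continuous_id
  equivariant g x e := by
    change (u' g : A) • (u g : A) • E.act g x e = E.act g x e
    rw [smul_smul, ← Units.val_mul, h, Units.val_one, one_smul]

/-- Twisting commutes with Whitney sums. -/
def Iso.twistSum (hu : IsTwist α β u) (E F : GBundle α X) :
    Iso ((E.sum F).twist hu) ((E.twist hu).sum (F.twist hu)) where
  equiv x := LinearEquiv.refl A (E.Fiber x × F.Fiber x)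
  continuous_toFun := continuous_id
  continuous_invFun := continuous_id
  equivariant _ _ _ := rfl

/-- Twisting preserves the zero bundle. -/
def Iso.twistZero [ContinuousConstSMul G X] (hu : IsTwist α β u) :
    Iso ((zero α X).twist hu) (zero β X) where
  equiv _ := LinearEquiv.refl A PUnit.{v + 1}
  continuous_toFun := continuous_id
  continuous_invFun := continuous_id
  equivariant _ _ _ := rfl

/-- Twisting commutes with pullbacks. -/
def Iso.twistPullback [ContinuousConstSMul G X] (hu : IsTwist α β u) (f : C(X, Y))
    (hf : ∀ (g : G) x, f (g • x) = g • f x) (E : GBundle α Y) :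
    Iso ((E.pullback f hf).twist hu) ((E.twist hu).pullback f hf) where
  equiv x := LinearEquiv.refl A (E.Fiber (f x))
  continuous_toFun := continuous_id
  continuous_invFun := continuous_id
  -- The two actions differ only in whether `u g` is applied before or after the `A`-linear
  -- transport between fibers.
  equivariant g x _ := ((castFiber E.toABundle (hf g x).symm).map_smul _ _).symm

end GBundle

/-! ### Twisting isomorphism classes -/

variable {α β : G →* (A ≃ₐ[ℝ] A)} {u : G → Aˣ}

/-- Twisting isomorphism classes of bundles. -/
def IsoClass.twist (hu : IsTwist α β u) {X : Type w} [TopologicalSpace X] [MulAction G X] :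
    IsoClass α X → IsoClass β X :=
  Quotient.map (GBundle.twist hu) fun _ _ ⟨i⟩ => ⟨i.twist hu⟩

/-- Keeping `u'` general lets this serve for both inverse laws of `IsoClass.twistEquiv`, with the
roles of `u` and `u⁻¹` exchanged. -/
theorem IsoClass.twist_twist {u' : G → Aˣ} (hu : IsTwist α β u) (hu' : IsTwist β α u')
    (h : ∀ g, u' g * u g = 1) {X : Type w} [TopologicalSpace X] [MulAction G X]
    (ξ : IsoClass α X) :
    twist hu' (twist hu ξ) = ξ := by
  induction ξ using Quotient.inductionOn with
  | _ E => exact Quotient.sound ⟨.twistTwist hu hu' h E⟩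

/-- The isomorphism of monoids of isomorphism classes given by twisting. -/
def IsoClass.twistEquiv (hu : IsTwist α β u) (X : Type w) [TopologicalSpace X] [MulAction G X]
    [ContinuousConstSMul G X] : IsoClass α X ≃+ IsoClass β X where
  toFun := twist hu
  invFun := twist hu.symm
  left_inv := IsoClass.twist_twist hu hu.symm fun g => inv_mul_cancel (u g)
  right_inv := IsoClass.twist_twist hu.symm hu fun g => mul_inv_cancel (u g)
  map_add' ξ η := by
    induction ξ, η using Quotient.inductionOn₂ with
    | _ E F => exact Quotient.sound ⟨.twistSum hu E F⟩

theorem IsoClass.twistEquiv_pullback (hu : IsTwist α β u) {X Y : Type w} [TopologicalSpace X]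
    [MulAction G X] [ContinuousConstSMul G X] [TopologicalSpace Y] [MulAction G Y]
    [ContinuousConstSMul G Y] (f : C(X, Y)) (hf : ∀ (g : G) x, f (g • x) = g • f x)
    (ξ : IsoClass α Y) :
    twistEquiv hu X (pullback α f hf ξ) = pullback β f hf (twistEquiv hu Y ξ) := by
  induction ξ using Quotient.inductionOn with
  | _ E => exact Quotient.sound ⟨.twistPullback hu f hf E⟩

end Twist

/-! ### Functoriality of the Grothendieck group -/

section Grothendieck

open Algebra

variable {M N P : Type*} [AddCommMonoid M] [AddCommMonoid N] [AddCommMonoid P]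

/-- The homomorphism of Grothendieck groups induced by a homomorphism of monoids. -/
noncomputable def grothendieckMap (f : M →+ N) :
    GrothendieckAddGroup M →+ GrothendieckAddGroup N :=
  GrothendieckAddGroup.lift (GrothendieckAddGroup.of.comp f)

theorem grothendieckMap_comp_of (f : M →+ N) :
    (grothendieckMap f).comp GrothendieckAddGroup.of = GrothendieckAddGroup.of.comp f :=
  GrothendieckAddGroup.lift.symm_apply_apply _

/-- By the universal property it suffices to compare the two maps on the classes of elements of `M`.
-/
theorem grothendieckMap_comp (g : N →+ P) (f : M →+ N) :
    (grothendieckMap g).comp (grothendieckMap f) = grothendieckMap (g.comp f) := by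
  apply GrothendieckAddGroup.lift.symm.injective
  change ((grothendieckMap g).comp (grothendieckMap f)).comp GrothendieckAddGroup.of =
    (grothendieckMap (g.comp f)).comp GrothendieckAddGroup.of
  rw [grothendieckMap_comp_of, AddMonoidHom.comp_assoc, grothendieckMap_comp_of,
    ← AddMonoidHom.comp_assoc, grothendieckMap_comp_of, AddMonoidHom.comp_assoc]

theorem grothendieckMap_id : grothendieckMap (AddMonoidHom.id M) = AddMonoidHom.id _ :=
  GrothendieckAddGroup.lift.symm.injective (grothendieckMap_comp_of _)

/-- The isomorphism of Grothendieck groups induced by an isomorphism of monoids. -/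
noncomputable def grothendieckCongr (e : M ≃+ N) :
    GrothendieckAddGroup M ≃+ GrothendieckAddGroup N :=
  AddMonoidHom.toAddEquiv (grothendieckMap e.toAddMonoidHom)
    (grothendieckMap e.symm.toAddMonoidHom)
    (by rw [grothendieckMap_comp, ← grothendieckMap_id]; congr 1; ext; simp)
    (by rw [grothendieckMap_comp, ← grothendieckMap_id]; congr 1; ext; simp)

end Grothendieck

/-- Naturality holds already for isomorphism classes, because twisting commutes with pullback, and
functoriality carries it to Grothendieck groups. -/
theorem kTheoryIso_of_isTwist {G : Type u} [Group G] {A : Type v} [NormedRing A]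
    [NormedAlgebra ℝ A] {α β : G →* (A ≃ₐ[ℝ] A)} {c : G → Aˣ} (hc : IsTwist α β c) :
    KTheoryIso.{u, v, w} α β := by
  refine ⟨fun X _ _ _ => grothendieckCongr (IsoClass.twistEquiv hc X), ?_⟩
  intro X Y _ _ _ _ _ _ f hf ξ
  have h : (grothendieckMap (IsoClass.twistEquiv hc X).toAddMonoidHom).comp
        (grothendieckMap (IsoClass.pullback α f hf)) =
      (grothendieckMap (IsoClass.pullback β f hf)).comp
        (grothendieckMap (IsoClass.twistEquiv hc Y).toAddMonoidHom) := by
    rw [grothendieckMap_comp, grothendieckMap_comp]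
    congr 1
    exact AddMonoidHom.ext (IsoClass.twistEquiv_pullback hc f hf)
  -- `KGroup.pullback` is by definition the `grothendieckMap` of `IsoClass.pullback`.
  exact DFunLike.congr_fun h ξ

end EquivariantBundles

theorem mainTheorem5 :
    -- (a)
    (∀ (G A : Type*) [Group G] [Ring A] [MulSemiringAction G A] (x : G →* Aˣ),
      (∀ (g : G) (a : A), g • a = (x g : A) * a * ((x g)⁻¹ : Aˣ)) →
      ∃ e : SkewMonoidAlgebra A G ≃+* MonoidAlgebra A G,
        ∀ a : A, e (SkewMonoidAlgebra.single 1 a) = MonoidAlgebra.single 1 a) ∧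
    -- (b)
    (∀ (k G A C : Type*) [CommRing k] [Group G]
      [Ring A] [Algebra k A] [MulSemiringAction G A] [SMulCommClass G k A]
      [Ring C] [Algebra k C] [MulSemiringAction G C] [SMulCommClass G k C] (x : G →* Aˣ),
      (∀ (g : G) (a : A), g • a = (x g : A) * a * ((x g)⁻¹ : Aˣ)) →
      letI := EquivariantBundles.diagonalAction k G C A
      ∃ e : SkewMonoidAlgebra (TensorProduct k C A) G ≃ₐ[k]
          TensorProduct k (SkewMonoidAlgebra C G) A,
        ∀ (c : C) (a : A), e (SkewMonoidAlgebra.single 1 (c ⊗ₜ[k] a)) =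
          SkewMonoidAlgebra.single 1 c ⊗ₜ[k] a) ∧
    -- (c)
    (∀ (G : Type u) (A : Type v) [Group G] [Finite G] [NormedRing A] [NormedAlgebra ℝ A]
      [FiniteDimensional ℝ A],
      (∀ (α : G →* (A ≃ₐ[ℝ] A)) (x : G →* Aˣ),
        (∀ (g : G) (a : A), α g a = (x g : A) * a * ((x g)⁻¹ : Aˣ)) →
        EquivariantBundles.KTheoryIso.{u, v, w} α 1) ∧
      (∀ (α β : G →* (A ≃ₐ[ℝ] A)) (x y : G →* Aˣ),
        (∀ (g : G) (a : A), α g a = (x g : A) * a * ((x g)⁻¹ : Aˣ)) →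
        (∀ (g : G) (a : A), β g a = (y g : A) * a * ((y g)⁻¹ : Aˣ)) →
        EquivariantBundles.KTheoryIso.{u, v, w} α β)) := by
  refine ⟨fun G A _ _ _ x hx => ⟨SkewMonoidAlgebra.innerEquiv x hx,
      SkewMonoidAlgebra.innerEquiv_single_one x hx⟩, ?_, ?_⟩
  · intro k G A C _ _ _ _ _ _ _ _ _ _ x hx
    refine ⟨SkewMonoidAlgebra.tensorInnerEquiv x hx, fun c a => ?_⟩
    refine (SkewMonoidAlgebra.tensorInner_single x hx 1 c a).trans ?_
    rw [map_one, Units.val_one, mul_one]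
  · intro G A _ _ _ _ _
    exact ⟨fun α x hx => EquivariantBundles.kTheoryIso_of_isTwist
        -- The trivial action is inner through the trivial homomorphism, so the twisting cocycle is
        -- `g ↦ (x g)⁻¹`.
        (.of_inner x 1 hx fun g a => by simp),
      fun α β x y hx hy => EquivariantBundles.kTheoryIso_of_isTwist (.of_inner x y hx hy)⟩
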